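/- Let $M$ be a smooth $2$-dimensional manifold with a smooth free action $m$ of the multiplicative group $\mathbb{R}_{>0}$, write $m_\lambda=m(\lambda,\cdot)$, and let $P_x=\frac{d}{dt}\big|_{t=0}m(e^t,x)$ be the vector field generating the action. Let $g$ be a pseudo-Riemannian metric on $M$, $f:M\to\mathbb{R}_{>0}$ a smooth function and $\alpha\in\mathbb{R}\setminus\{0\}$ such that $(g,f)$ is a homogeneous pair of degree $\alpha$, that is, $$m_\lambda^*g=\lambda^\alpha g,\qquad m_\lambda^*f=\lambda^\alpha f\quad(\lambda>0),\qquad g(P,\cdot)=df .$$ Let $\Delta_1,\Delta_2,\Delta_3\subset\mathbb{R}^3$ be the sets of those $(s,C_1,C_2)$ with $s>0,\ C_1>0$, respectively $s=0,\ C_1\ge 0$, respectively $s<0,\ C_1\le 0$. For $(s,C_1,C_2)\in\Delta_1\cup\Delta_2\cup\Delta_3$ set $$w(s,C_1,C_2,r)=\begin{cases}\dfrac{C_1}{s\,\cosh^2\!\big(\sqrt{C_1}\,(\log r+C_2)\big)} & s>0,\\[2mm] e^{C_2}\,r^{\pm2\sqrt{C_1}} & s=0\ \text{(either choice of the sign)},\\[1mm]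 \dfrac{C_1}{s\,\sin^2\!\big(\sqrt{-C_1}\,(\log r+C_2)\big)} & s<0,\ C_1<0,\\[2mm] \dfrac{-1}{s\,(\log r+C_2)^2} & s<0,\ C_1=0,\end{cases}$$ for all $r$ in the set $D(s,C_1,C_2)$ of those $r>0$ at which the denominator does not vanish (so $D(s,C_1,C_2)=\mathbb{R}_{>0}$ if $s\ge 0$). Then for all $C,C_1,C_2\in\mathbb{R}$ with $(C/\alpha,C_1,C_2)\in\Delta_1\cup\Delta_2\cup\Delta_3$, setting $$v(r)=\frac1r\,w\!\left(\frac C\alpha,C_1,C_2,r\right)\qquad (r\in D(C/\alpha,C_1,C_2)),$$ the function $v\circ f$ is positive on the open set $U=f^{-1}(D(C/\alpha,C_1,C_2))$ (which is all of $M$ if $C/\alpha\ge 0$), and $(v\circ f)\,g$ is a pseudo-Riemannian metric on $U$ of constant sectional curvature $C$. Thus for each $C$ one obtains such metrics depending on the two parameters $C_1,C_2$. In particular, for every $\beta\in\mathbb{R}$, $f^\beta g$ is a flat pseudo-Riemannian metric on $M$. -/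

import Mathlib

open Set
open scoped Manifold ContDiff Topology

noncomputable section

namespace HomogeneousPair

/-! ### Curvature of a field of bilinear forms on an open subset of a vector space -/

section Coordinates

variable {E : Type*} [NormedAddCommGroup E] [NormedSpace ℝ E]

/-- The Koszul covector
`w ↦ ½ (D_u G (v, w) + D_v G (u, w) - D_w G (u, v))` of a field `G` of bilinear forms on `E`,
at the point `y`. -/
def koszul (G : E → E →L[ℝ] E →L[ℝ] ℝ) (y u v : E) : E →L[ℝ] ℝ :=
  (1 / 2 : ℝ) • ((fderiv ℝ G y u) v + (fderiv ℝ G y v) u - ((fderiv ℝ G y).flip u).flip v)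

/-- The Christoffel symbols: `christoffel G y u v` is the vector `Γ_y(u, v)` with
`G_y(Γ_y(u, v), w) = ½ (D_u G (v, w) + D_v G (u, w) - D_w G (u, v))` for all `w`,
that is, `∇_u v` for the Levi-Civita connection of `G` and the constant fields `u`, `v`. -/
def christoffel (G : E → E →L[ℝ] E →L[ℝ] ℝ) (y u v : E) : E :=
  (G y).inverse (koszul G y u v)

/-- The curvature tensor `R(u, v) w = ∇_u ∇_v w - ∇_v ∇_u w` of `G` at `y`
(`u`, `v`, `w` being extended to constant fields, so that `[u, v] = 0`):
`(D_u Γ)(v, w) - (D_v Γ)(u, w) + Γ(u, Γ(v, w)) - Γ(v, Γ(u, w))`. -/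
def coordCurvature (G : E → E →L[ℝ] E →L[ℝ] ℝ) (y u v w : E) : E :=
  fderiv ℝ (fun z => christoffel G z v w) y u - fderiv ℝ (fun z => christoffel G z u w) y v
    + christoffel G y u (christoffel G y v w) - christoffel G y v (christoffel G y u w)

end Coordinates

section Manifold

variable {E : Type*} [NormedAddCommGroup E] [NormedSpace ℝ E]
  {M : Type*} [TopologicalSpace M] [ChartedSpace E M]

/-! ### Pseudo-Riemannian metrics -/

/-- `g` restricts to a (smooth) pseudo-Riemannian metric on the open subset `U` of `M`:
on `U` it is symmetric, nondegenerate, and a smooth section of the bundle of bilinear forms on the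
tangent spaces. The values of `g` outside `U` are irrelevant. -/
structure IsPseudoRiemannianMetricOn [IsManifold 𝓘(ℝ, E) ∞ M]
    (g : ∀ x : M, TangentSpace 𝓘(ℝ, E) x →L[ℝ] TangentSpace 𝓘(ℝ, E) x →L[ℝ] ℝ)
    (U : Set M) : Prop where
  isOpen : IsOpen U
  symm : ∀ x ∈ U, ∀ u v : TangentSpace 𝓘(ℝ, E) x, g x u v = g x v u
  nondegenerate : ∀ x ∈ U, ∀ u : TangentSpace 𝓘(ℝ, E) x,
    (∀ v : TangentSpace 𝓘(ℝ, E) x, g x u v = 0) → u = 0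
  smooth : ContMDiffOn 𝓘(ℝ, E) (𝓘(ℝ, E).prod 𝓘(ℝ, E →L[ℝ] E →L[ℝ] ℝ)) ∞
    (fun x ↦ Bundle.TotalSpace.mk' (E →L[ℝ] E →L[ℝ] ℝ)
      (E := fun x : M ↦ TangentSpace 𝓘(ℝ, E) x →L[ℝ] TangentSpace 𝓘(ℝ, E) x →L[ℝ] ℝ) x (g x)) U

/-- The coordinate expression of `g` in the chart `e`: the pullback of `g` under `e⁻¹`. -/
def metricInChart
    (g : ∀ x : M, TangentSpace 𝓘(ℝ, E) x →L[ℝ] TangentSpace 𝓘(ℝ, E) x →L[ℝ] ℝ)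
    (e : OpenPartialHomeomorph M E) (y : E) : E →L[ℝ] E →L[ℝ] ℝ :=
  let G : E →L[ℝ] E →L[ℝ] ℝ := g (e.symm y)
  let D : E →L[ℝ] E := mfderiv 𝓘(ℝ, E) 𝓘(ℝ, E) e.symm y
  G.bilinearComp D D

/-- The curvature tensor `R^g(A, B) Z ∈ T_x M` of (the Levi-Civita connection of) `g` at `x`,
computed in a chart `e` around `x`: the tangent vectors are transported to the model space by the
derivative of `e`, the curvature of the coordinate expression of `g` is applied to them, and the
result is transported back. -/
def curvature
    (g : ∀ x : M, TangentSpace 𝓘(ℝ, E) x →L[ℝ] TangentSpace 𝓘(ℝ, E) x →L[ℝ] ℝ)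
    (e : OpenPartialHomeomorph M E) (x : M) (A B Z : TangentSpace 𝓘(ℝ, E) x) :
    TangentSpace 𝓘(ℝ, E) x :=
  (mfderiv 𝓘(ℝ, E) 𝓘(ℝ, E) e x).inverse
    (coordCurvature (E := E) (metricInChart g e) (e x) (mfderiv 𝓘(ℝ, E) 𝓘(ℝ, E) e x A)
      (mfderiv 𝓘(ℝ, E) 𝓘(ℝ, E) e x B) (mfderiv 𝓘(ℝ, E) 𝓘(ℝ, E) e x Z))

/-- The sectional curvature
`K^g(A, B) = g(R^g(A, B) B, A) / (g(A, A) g(B, B) - g(A, B)²)`, computed in the chart `e`. -/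
def sectionalCurvature
    (g : ∀ x : M, TangentSpace 𝓘(ℝ, E) x →L[ℝ] TangentSpace 𝓘(ℝ, E) x →L[ℝ] ℝ)
    (e : OpenPartialHomeomorph M E) (x : M) (A B : TangentSpace 𝓘(ℝ, E) x) : ℝ :=
  g x (curvature g e x A B B) A / (g x A A * g x B B - g x A B ^ 2)

/-- `g` has constant sectional curvature `C` on `U`: at every point of `U`, and in every smooth
chart around it, `K^g(A, B) = C` for all `A`, `B` that span a nondegenerate plane. (When the
tangent spaces have dimension two, the plane is the whole tangent space, hence nondegenerate
as soon as `A`, `B` are linearly independent.) -/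
def HasConstSectionalCurvatureOn
    (g : ∀ x : M, TangentSpace 𝓘(ℝ, E) x →L[ℝ] TangentSpace 𝓘(ℝ, E) x →L[ℝ] ℝ)
    (U : Set M) (C : ℝ) : Prop :=
  ∀ e ∈ IsManifold.maximalAtlas 𝓘(ℝ, E) ∞ M, ∀ x ∈ e.source ∩ U,
    ∀ A B : TangentSpace 𝓘(ℝ, E) x, LinearIndependent ℝ ![A, B] →
      g x A A * g x B B - g x A B ^ 2 ≠ 0 → sectionalCurvature g e x A B = C

/-- `g` is flat on `U`: its curvature tensor vanishes at every point of `U`. -/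
def IsFlatOn
    (g : ∀ x : M, TangentSpace 𝓘(ℝ, E) x →L[ℝ] TangentSpace 𝓘(ℝ, E) x →L[ℝ] ℝ)
    (U : Set M) : Prop :=
  ∀ e ∈ IsManifold.maximalAtlas 𝓘(ℝ, E) ∞ M, ∀ x ∈ e.source ∩ U,
    ∀ A B Z : TangentSpace 𝓘(ℝ, E) x, curvature g e x A B Z = 0

/-- The tensor field `(v ∘ f) g`. -/
def conformal
    (g : ∀ x : M, TangentSpace 𝓘(ℝ, E) x →L[ℝ] TangentSpace 𝓘(ℝ, E) x →L[ℝ] ℝ)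
    (f : M → ℝ) (v : ℝ → ℝ) (x : M) :
    TangentSpace 𝓘(ℝ, E) x →L[ℝ] TangentSpace 𝓘(ℝ, E) x →L[ℝ] ℝ :=
  v (f x) • g x

/-! ### Actions of the positive reals and homogeneous pairs -/

/-- The point `e^t` of the multiplicative group of positive reals. -/
def posExp (t : ℝ) : {t : ℝ // 0 < t} := ⟨Real.exp t, Real.exp_pos t⟩

variable [MulAction {t : ℝ // 0 < t} M]

variable (E M) in
/-- The action of the positive reals on `M` is smooth and free. Smoothness is expressed through
the isomorphism of Lie groups `t ↦ e^t` from `ℝ` to the positive reals. -/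
structure IsSmoothFreeAction : Prop where
  smooth : ContMDiff (𝓘(ℝ, ℝ).prod 𝓘(ℝ, E)) 𝓘(ℝ, E) ∞ (fun p : ℝ × M ↦ posExp p.1 • p.2)
  free : ∀ (t : {t : ℝ // 0 < t}) (x : M), t • x = x → t = 1

/-- The vector field `P` generated by the action, `P_x = d/dt|_{t = 0} (e^t • x)`. -/
def generator (x : M) : TangentSpace 𝓘(ℝ, E) x :=
  (mfderiv 𝓘(ℝ, ℝ) 𝓘(ℝ, E) (fun t : ℝ ↦ posExp t • x) 0 (1 : ℝ) : E)

/-- `(g, f)` is a homogeneous pair of degree `α` on `M`: here `g` is a pseudo-Riemannian metric on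
`M`, which carries a smooth free action `m` of the positive reals, `f` is a smooth positive
function, `α ≠ 0`, and `m_λ^* g = λ^α g`, `m_λ^* f = λ^α f`, `g(P, ·) = df`. -/
structure IsHomogeneousPair [IsManifold 𝓘(ℝ, E) ∞ M]
    (g : ∀ x : M, TangentSpace 𝓘(ℝ, E) x →L[ℝ] TangentSpace 𝓘(ℝ, E) x →L[ℝ] ℝ)
    (f : M → ℝ) (α : ℝ) : Prop where
  metric : IsPseudoRiemannianMetricOn g univ
  action : IsSmoothFreeAction E M
  smooth : ContMDiff 𝓘(ℝ, E) 𝓘(ℝ, ℝ) ∞ f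
  pos : ∀ x, 0 < f x
  degree_ne_zero : α ≠ 0
  metric_homogeneous : ∀ (l : {t : ℝ // 0 < t}) (x : M) (u v : TangentSpace 𝓘(ℝ, E) x),
    g (l • x) (mfderiv 𝓘(ℝ, E) 𝓘(ℝ, E) (fun z : M ↦ l • z) x u)
      (mfderiv 𝓘(ℝ, E) 𝓘(ℝ, E) (fun z : M ↦ l • z) x v) = (l : ℝ) ^ α * g x u v
  function_homogeneous : ∀ (l : {t : ℝ // 0 < t}) (x : M), f (l • x) = (l : ℝ) ^ α * f x
  generator_eq : ∀ (x : M) (v : TangentSpace 𝓘(ℝ, E) x),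
    g x (generator x) v = mvfderiv 𝓘(ℝ, E) f x v

end Manifold

/-! ### The profile functions `w` -/

/-- The parameters `(s, C₁, C₂)` with `s > 0` and `C₁ > 0`. -/
def Δ₁ : Set (ℝ × ℝ × ℝ) := {p | 0 < p.1 ∧ 0 < p.2.1}

/-- The parameters `(s, C₁, C₂)` with `s = 0` and `C₁ ≥ 0`. -/
def Δ₂ : Set (ℝ × ℝ × ℝ) := {p | p.1 = 0 ∧ 0 ≤ p.2.1}

/-- The parameters `(s, C₁, C₂)` with `s < 0` and `C₁ ≤ 0`. -/
def Δ₃ : Set (ℝ × ℝ × ℝ) := {p | p.1 < 0 ∧ p.2.1 ≤ 0}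

/-- The function `w(s, C₁, C₂, r)` for `(s, C₁, C₂) ∈ Δ₁ ∪ Δ₂ ∪ Δ₃` and `r` in
`wDomain s C₁ C₂`. For `s = 0` the formula has a sign `±`, which is the argument `σ`;
for `s ≠ 0` the value does not depend on `σ`. -/
def w (σ : ℤˣ) (s C₁ C₂ r : ℝ) : ℝ :=
  if 0 < s then C₁ / (s * Real.cosh (√C₁ * (Real.log r + C₂)) ^ 2)
  else if s = 0 then Real.exp C₂ * r ^ (((σ : ℤ) : ℝ) * (2 * √C₁))
  else if C₁ < 0 then C₁ / (s * Real.sin (√(-C₁) * (Real.log r + C₂)) ^ 2)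
  else -1 / (s * (Real.log r + C₂) ^ 2)

/-- The set of those `r > 0` at which `w(s, C₁, C₂, r)` is defined, that is, at which the
denominators do not vanish. -/
def wDomain (s C₁ C₂ : ℝ) : Set ℝ :=
  {r | 0 < r ∧ (s < 0 → C₁ < 0 → Real.sin (√(-C₁) * (Real.log r + C₂)) ≠ 0) ∧
    (s < 0 → C₁ = 0 → Real.log r + C₂ ≠ 0)}

end HomogeneousPair

end

noncomputable section

namespace HomogeneousPair

/-! Write `ĝ = v(f) g`. Homogeneity of `g` says `L_P g = α g`, and `g(P, ·) = df` with `df(P) = α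
f`. Hence `P` stays conformal for `ĝ`: `L_P ĝ = 2 κ(f) ĝ` with `2 κ v = α (r v' + v)`. Its dual
`ĝ(P, ·) = v(f) df` is still closed. The conformal equation fixes the symmetric part of `∇̂P` and
closedness kills the skew part, so `∇̂_u P = κ(f) u`.

Differentiating once more gives `R̂(u, v) P = dκ(u) v - dκ(v) u`. If `κ' = -C v`, then `d(κ(f)) = -C
ĝ(P, ·)`, and `R̂(u, v)` agrees on `P` with the tensor of constant curvature `C`. The difference of
the two is a skew endomorphism of a plane that kills `P`. Since `ĝ(P, P) = α f v(f) ≠ 0`, it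
vanishes. This is `IsCoordMetric.coordCurvature_eq_of_conformal_field`, applied to `ĝ` in
`IsCoordPair.coordCurvature_conformal`.

What remains is an ODE. Put `v = w / r`, `s = C / α` and `κ = α k`. The two conditions become `r w'
= 2 k w` and `r k' = -s w`, a Liouville equation for `log w` in the variable `log r`. The functions
`w` solve it (`isProfile_w`). Powers of `r` solve it with `s = 0`, which gives the flat metrics.

Curvature is defined through charts, so the geometry is carried out for fields on an open subset of
`E`. `IsHomogeneousPair.isCoordPair` transfers the hypotheses there, the Lie derivative arising by
differentiating the pullback relation along the flow. -/

theorem two_le_infty : (2 : WithTop ℕ∞) ≤ ∞ := ENat.LEInfty.out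

/-! ### Levi-Civita calculus in coordinates, and curvature from a conformal field with closed dual.
-/

section Coordinates

set_option maxSynthPendingDepth 5

variable {E : Type*} [NormedAddCommGroup E] [NormedSpace ℝ E]

/-- The Koszul covector, as a bilinear map in the two vector arguments. -/
def koszulCLM (G : E → E →L[ℝ] E →L[ℝ] ℝ) (y : E) : E →L[ℝ] E →L[ℝ] E →L[ℝ] ℝ :=
  (1 / 2 : ℝ) • (fderiv ℝ G y + (fderiv ℝ G y).flip -
    ((ContinuousLinearMap.flipₗᵢ ℝ E E ℝ : (E →L[ℝ] E →L[ℝ] ℝ) →L[ℝ] E →L[ℝ] E →L[ℝ] ℝ)).comp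
      (fderiv ℝ G y).flip)

/-- The Christoffel symbols at a point, as a bilinear map. -/
def christoffelCLM (G : E → E →L[ℝ] E →L[ℝ] ℝ) (y : E) : E →L[ℝ] E →L[ℝ] E :=
  (ContinuousLinearMap.compL ℝ E (E →L[ℝ] ℝ) E (G y).inverse).comp (koszulCLM G y)

theorem koszulCLM_apply (G : E → E →L[ℝ] E →L[ℝ] ℝ) (y u v : E) :
    koszulCLM G y u v = koszul G y u v := by
  ext w
  simp [koszulCLM, koszul]

theorem koszul_apply (G : E → E →L[ℝ] E →L[ℝ] ℝ) (y u v w : E) :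
    koszul G y u v w =
      (1 / 2) * (fderiv ℝ G y u v w + fderiv ℝ G y v u w - fderiv ℝ G y w u v) := by
  simp [koszul]

theorem christoffelCLM_apply (G : E → E →L[ℝ] E →L[ℝ] ℝ) (y u v : E) :
    christoffelCLM G y u v = christoffel G y u v := by
  simp [christoffelCLM, christoffel, koszulCLM_apply]

/-- An injective map into the dual, which has the same dimension, is bijective. This makes `inverse`
in the Christoffel symbols a genuine inverse rather than its default value `0`. -/
theorem isInvertible_of_nondegenerate [FiniteDimensional ℝ E] {B : E →L[ℝ] E →L[ℝ] ℝ}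
    (h : ∀ u, (∀ v, B u v = 0) → u = 0) : B.IsInvertible := by
  have hinj : Function.Injective (B : E →ₗ[ℝ] (E →L[ℝ] ℝ)) := by
    rw [injective_iff_map_eq_zero]
    intro u hu
    exact h u fun v ↦ by
      have : B u = 0 := hu
      simp [this]
  have hfin : Module.finrank ℝ E = Module.finrank ℝ (E →L[ℝ] ℝ) := by
    rw [← (LinearMap.toContinuousLinearMap (𝕜 := ℝ) (E := E) (F' := ℝ)).finrank_eq]
    exact (Subspace.dual_finrank_eq (K := ℝ) (V := E)).symm
  let L := LinearEquiv.ofInjectiveOfFinrankEq (B : E →ₗ[ℝ] (E →L[ℝ] ℝ)) hinj hfin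
  refine ⟨L.toContinuousLinearEquiv, ?_⟩
  ext u v
  rfl

/-- A smooth field of symmetric nondegenerate bilinear forms on an open subset of `E`. -/
structure IsCoordMetric (G : E → E →L[ℝ] E →L[ℝ] ℝ) (s : Set E) : Prop where
  isOpen : IsOpen s
  smooth : ContDiffOn ℝ ∞ G s
  symm : ∀ y ∈ s, ∀ u v, G y u v = G y v u
  nondegenerate : ∀ y ∈ s, ∀ u, (∀ v, G y u v = 0) → u = 0

namespace IsCoordMetric

variable {G : E → E →L[ℝ] E →L[ℝ] ℝ} {s : Set E}

theorem contDiffAt (h : IsCoordMetric G s) {y : E} (hy : y ∈ s) : ContDiffAt ℝ ∞ G y :=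
  h.smooth.contDiffAt (h.isOpen.mem_nhds hy)

theorem hasFDerivAt (h : IsCoordMetric G s) {y : E} (hy : y ∈ s) :
    HasFDerivAt G (fderiv ℝ G y) y :=
  ((h.contDiffAt hy).differentiableAt (by simp)).hasFDerivAt

theorem fderiv_symm (h : IsCoordMetric G s) {y : E} (hy : y ∈ s) (u v w : E) :
    fderiv ℝ G y u v w = fderiv ℝ G y u w v := by
  have h1 := ((h.hasFDerivAt hy).clm_apply (hasFDerivAt_const v y)).clm_apply
    (hasFDerivAt_const w y)
  have h2 := ((h.hasFDerivAt hy).clm_apply (hasFDerivAt_const w y)).clm_apply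
    (hasFDerivAt_const v y)
  have h3 : (fun z ↦ G z v w) =ᶠ[𝓝 y] fun z ↦ G z w v := by
    filter_upwards [h.isOpen.mem_nhds hy] with z hz using h.symm z hz v w
  have := DFunLike.congr_fun (h1.unique (h2.congr_of_eventuallyEq h3)) u
  simpa using this

variable [FiniteDimensional ℝ E]

theorem isInvertible (h : IsCoordMetric G s) {y : E} (hy : y ∈ s) : (G y).IsInvertible :=
  isInvertible_of_nondegenerate (h.nondegenerate y hy)

/-- Lowering the index removes the inverse of `G`; torsion-freeness and metric compatibility are
later read off from this formula. -/
theorem apply_christoffel (h : IsCoordMetric G s) {y : E} (hy : y ∈ s) (u v w : E) :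
    G y (christoffel G y u v) w =
      (1 / 2) * (fderiv ℝ G y u v w + fderiv ℝ G y v u w - fderiv ℝ G y w u v) := by
  have : G y (christoffel G y u v) = koszul G y u v :=
    (h.isInvertible hy).self_apply_inverse _
  rw [this, koszul_apply]

theorem contDiffAt_inverse (h : IsCoordMetric G s) {y : E} (hy : y ∈ s) :
    ContDiffAt ℝ ∞ (fun z ↦ (G z).inverse) y :=
  have : CompleteSpace E := FiniteDimensional.complete ℝ E
  (h.isInvertible hy).contDiffAt_map_inverse.comp y (h.contDiffAt hy)

/-- Inversion is smooth at invertible maps, and the Koszul form is a fixed linear expression in the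
derivative of `G`. -/
theorem contDiffAt_christoffelCLM (h : IsCoordMetric G s) {y : E} (hy : y ∈ s) :
    ContDiffAt ℝ ∞ (christoffelCLM G) y := by
  have hd : ContDiffAt ℝ ∞ (fderiv ℝ G) y := (h.contDiffAt hy).fderiv_right (by simp)
  have hf : ContDiffAt ℝ ∞ (fun z ↦ (fderiv ℝ G z).flip) y :=
    (ContinuousLinearMap.flipₗᵢ ℝ E E (E →L[ℝ] ℝ)).toContinuousLinearEquiv.contDiff.contDiffAt.comp
      y hd
  exact ((ContinuousLinearMap.compL ℝ E (E →L[ℝ] ℝ) E).contDiff.contDiffAt.comp y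
    (h.contDiffAt_inverse hy)).clm_comp (((hd.add hf).sub (contDiffAt_const.clm_comp hf)).const_smul _)

theorem hasFDerivAt_christoffelCLM (h : IsCoordMetric G s) {y : E} (hy : y ∈ s) :
    HasFDerivAt (christoffelCLM G) (fderiv ℝ (christoffelCLM G) y) y :=
  ((h.contDiffAt_christoffelCLM hy).differentiableAt (by simp)).hasFDerivAt

theorem fderiv_christoffel (h : IsCoordMetric G s) {y : E} (hy : y ∈ s) (u v w : E) :
    fderiv ℝ (fun z ↦ christoffel G z v w) y u = fderiv ℝ (christoffelCLM G) y u v w := by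
  have h1 := ((h.hasFDerivAt_christoffelCLM hy).clm_apply (hasFDerivAt_const v y)).clm_apply
    (hasFDerivAt_const w y)
  simp only [christoffelCLM_apply] at h1
  rw [h1.fderiv]
  simp

/-- In this form the linearity of the curvature in `w` is visible, as needed to treat it as an
endomorphism. -/
theorem coordCurvature_eq (h : IsCoordMetric G s) {y : E} (hy : y ∈ s) (u v w : E) :
    coordCurvature G y u v w =
      fderiv ℝ (christoffelCLM G) y u v w - fderiv ℝ (christoffelCLM G) y v u w
        + christoffelCLM G y u (christoffelCLM G y v w)
        - christoffelCLM G y v (christoffelCLM G y u w) := by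
  simp only [coordCurvature, h.fderiv_christoffel hy, christoffelCLM_apply]

/-- The curvature endomorphism is skew-symmetric. -/
theorem apply_coordCurvature_self (h : IsCoordMetric G s) {y : E} (hy : y ∈ s) (u v w : E) :
    G y (coordCurvature G y u v w) w = 0 := by
  have hd : HasFDerivAt (fderiv ℝ G) (fderiv ℝ (fderiv ℝ G) y) y :=
    (((h.contDiffAt hy).fderiv_right (m := ∞) (by simp)).differentiableAt (by simp)).hasFDerivAt
  -- With equal last arguments two Koszul terms cancel, leaving `G(Γ(u, w), w) = ½ (D_u G)(w, w)`;
  -- differentiate this along `v`.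
  have key (u v : E) : G y (fderiv ℝ (christoffelCLM G) y v u w) w
      = 1 / 2 * fderiv ℝ (fderiv ℝ G) y v u w w - fderiv ℝ G y v (christoffel G y u w) w := by
    have h1 := ((h.hasFDerivAt hy).clm_apply
      (((h.hasFDerivAt_christoffelCLM hy).clm_apply (hasFDerivAt_const u y)).clm_apply
      (hasFDerivAt_const w y))).clm_apply (hasFDerivAt_const w y)
    have h2 := (((hd.clm_apply (hasFDerivAt_const u y)).clm_apply
      (hasFDerivAt_const w y)).clm_apply (hasFDerivAt_const w y)).const_mul (1 / 2 : ℝ)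
    have h3 : (fun z ↦ G z (christoffelCLM G z u w) w)
        =ᶠ[𝓝 y] fun z ↦ 1 / 2 * fderiv ℝ G z u w w := by
      filter_upwards [h.isOpen.mem_nhds hy] with z hz
      rw [christoffelCLM_apply, h.apply_christoffel hz, h.fderiv_symm hz w u w]
      ring
    have := DFunLike.congr_fun (h1.unique (h2.congr_of_eventuallyEq h3)) v
    simp [christoffelCLM_apply] at this
    linarith
  have sym : fderiv ℝ (fderiv ℝ G) y u v = fderiv ℝ (fderiv ℝ G) y v u :=
    (h.contDiffAt hy).isSymmSndFDerivAt (by simpa using two_le_infty) u v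
  -- Metric compatibility, `∇G = 0`.
  have compat (u X : E) : fderiv ℝ G y u X w
      = G y (christoffel G y u X) w + G y (christoffel G y u w) X := by
    rw [h.apply_christoffel hy, h.apply_christoffel hy, h.fderiv_symm hy u w X,
      h.fderiv_symm hy w u X, h.fderiv_symm hy X u w]
    ring
  rw [h.coordCurvature_eq hy]
  simp only [christoffelCLM_apply, map_sub, map_add, sub_apply, add_apply, key, sym, compat]
  rw [h.symm y hy (christoffel G y u w) (christoffel G y v w)]
  ring

end IsCoordMetric

/-- A symmetric nondegenerate form on a plane: a skew endomorphism that kills a non-null vector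
vanishes. -/
theorem skew_eq_zero (hdim : Module.finrank ℝ E = 2) {B : E →L[ℝ] E →L[ℝ] ℝ}
    (nondeg : ∀ u, (∀ v, B u v = 0) → u = 0)
    {T : E →ₗ[ℝ] E} (skew : ∀ w, B (T w) w = 0) {p : E} (hp : B p p ≠ 0) (hT : T p = 0) :
    T = 0 := by
  ext w
  by_cases hw : LinearIndependent ℝ ![p, w]
  · refine nondeg _ fun v ↦ ?_
    have hspan := hw.span_eq_top_of_card_eq_finrank (by simp [hdim])
    have hv : v ∈ Submodule.span ℝ (Set.range ![p, w]) := hspan ▸ Submodule.mem_top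
    simp only [Matrix.range_cons, Matrix.range_empty, Set.union_empty, Set.singleton_union,
      Submodule.mem_span_pair] at hv
    obtain ⟨a, b, rfl⟩ := hv
    -- Polarization: since `T p = 0`, skewness at `p + w` reduces to `B (T w) p = 0`.
    have h1 := skew (p + w)
    have h2 := skew w
    simp [hT, h2] at h1
    simp [h1, h2]
  · rw [LinearIndependent.pair_iff' (by rintro rfl; simp at hp)] at hw
    push Not at hw
    obtain ⟨a, rfl⟩ := hw
    simp [hT]

/-- On a plane, let `P` be a non-null conformal vector field of `G` with closed metric dual
`G(P, ·)`, and let the conformal factor `κ` satisfy `dκ = -K G(P, ·)`. Then `G` has the curvature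
tensor of a metric of constant curvature `K`. -/
theorem IsCoordMetric.coordCurvature_eq_of_conformal_field (hdim : Module.finrank ℝ E = 2)
    {G : E → E →L[ℝ] E →L[ℝ] ℝ} {s : Set E} (h : IsCoordMetric G s)
    {P : E → E} (hP : ∀ y ∈ s, ContDiffAt ℝ 2 P y) {κ : E → ℝ} {K : ℝ}
    (lie : ∀ y ∈ s, ∀ u v, fderiv ℝ G y (P y) u v + G y (fderiv ℝ P y u) v
      + G y u (fderiv ℝ P y v) = 2 * κ y * G y u v)
    (closed : ∀ y ∈ s, ∀ u v, fderiv ℝ (fun z ↦ G z (P z)) y u v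
      = fderiv ℝ (fun z ↦ G z (P z)) y v u)
    (hκ : ∀ y ∈ s, HasFDerivAt κ (-(K • G y (P y))) y)
    (hPP : ∀ y ∈ s, G y (P y) (P y) ≠ 0) {y : E} (hy : y ∈ s) (u v w : E) :
    coordCurvature G y u v w = K • (G y v w • u - G y u w • v) := by
  have : FiniteDimensional ℝ E := Module.finite_of_finrank_eq_succ hdim
  -- `∇_u P = κ u`
  have nabla : ∀ z ∈ s, ∀ u, fderiv ℝ P z u = κ z • u - christoffelCLM G z u (P z) := by
    intro z hz u
    have hθ := (h.hasFDerivAt hz).clm_apply ((hP z hz).differentiableAt (by simp)).hasFDerivAt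
    rw [← sub_eq_zero]
    refine h.nondegenerate z hz _ fun v ↦ ?_
    -- Closedness says that `G(∇_u P, v)` is symmetric in `u`, `v`; the conformal equation gives its
    -- symmetric part as `κ G`.
    have h1 := closed z hz u v
    rw [hθ.fderiv] at h1
    have h2 := lie z hz u v
    simp [christoffelCLM_apply, h.apply_christoffel hz] at h1 ⊢
    rw [h.fderiv_symm hz v u (P z)]
    rw [h.symm z hz u] at h2
    linarith
  have hRP : ∀ u v, coordCurvature G y u v (P y) = K • (G y v (P y) • u - G y u (P y) • v) := by
    have hPd := ((hP y hy).differentiableAt (by simp)).hasFDerivAt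
    have hP2 : HasFDerivAt (fderiv ℝ P) (fderiv ℝ (fderiv ℝ P) y) y :=
      (((hP y hy).fderiv_right (m := 1) (by norm_num)).differentiableAt (by simp)).hasFDerivAt
    have hP3 (u v : E) : fderiv ℝ (fderiv ℝ P) y u v = fderiv ℝ (fderiv ℝ P) y v u :=
      (hP y hy).isSymmSndFDerivAt (by simp) u v
    -- Derivative along `u` of `D_v P = κ v - Γ(v, P)`, with `dκ = -K G(P, ·)` inserted and `D_u P`
    -- replaced by the same equation.
    have hc (u v : E) : fderiv ℝ (fderiv ℝ P) y u v = -(K * G y (P y) u) • v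
        - fderiv ℝ (christoffelCLM G) y u v (P y)
        - christoffelCLM G y v (κ y • u - christoffelCLM G y u (P y)) := by
      have h1 := hP2.clm_apply (hasFDerivAt_const v y)
      have h2 := ((hκ y hy).smul (hasFDerivAt_const v y)).sub
        (((h.hasFDerivAt_christoffelCLM hy).clm_apply (hasFDerivAt_const v y)).clm_apply hPd)
      have h3 : (fun z ↦ fderiv ℝ P z v)
          =ᶠ[𝓝 y] fun z ↦ κ z • v - christoffelCLM G z v (P z) := by
        filter_upwards [h.isOpen.mem_nhds hy] with z hz using nabla z hz v
      have h4 := DFunLike.congr_fun (h1.unique (h2.congr_of_eventuallyEq h3)) u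
      simp [nabla y hy] at h4
      rw [h4]
      simp
      module
    have hΓ (u v : E) : christoffelCLM G y u v = christoffelCLM G y v u := by
      rw [← sub_eq_zero]
      refine h.nondegenerate y hy _ fun w ↦ ?_
      simp only [christoffelCLM_apply, map_sub, sub_apply,
        h.apply_christoffel hy, h.fderiv_symm hy w u v]
      ring
    intro u v
    -- Symmetry of the second derivative of `P` is the integrability condition; its terms in `Γ`
    -- assemble to `R(u, v) P`, and those in `κ` cancel because `Γ` is symmetric.
    have h1 := hP3 u v
    rw [hc, hc] at h1
    simp only [map_sub, map_smul] at h1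
    rw [hΓ v u] at h1
    rw [h.coordCurvature_eq hy, h.symm y hy v, h.symm y hy u]
    rw [← sub_eq_zero] at h1 ⊢
    rw [← neg_eq_zero, ← h1]
    module
  -- The curvature minus its constant-curvature model: skew because both terms are, and zero on `P`.
  let T : E →ₗ[ℝ] E :=
    { toFun := fun w ↦ coordCurvature G y u v w - K • (G y v w • u - G y u w • v)
      map_add' := fun a b ↦ by
        simp only [h.coordCurvature_eq hy, map_add]
        module
      map_smul' := fun a b ↦ by
        simp only [h.coordCurvature_eq hy, map_smul, RingHom.id_apply, smul_eq_mul]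
        module }
  have hT : T = 0 := by
    refine skew_eq_zero hdim (h.nondegenerate y hy) (fun w ↦ ?_) (hPP y hy) ?_
    · have := h.apply_coordCurvature_self hy u v w
      simp [T, this]
      right; ring
    · simp [T, hRP]
  exact sub_eq_zero.mp (DFunLike.congr_fun hT w)

end Coordinates

/-! ### The conformal change of a homogeneous pair in coordinates. -/

section ConformalChange

set_option maxSynthPendingDepth 5

variable {E : Type*} [NormedAddCommGroup E] [NormedSpace ℝ E]

/-- A homogeneous pair of degree `α`, expressed in coordinates: `P` is a conformal vector field of
`G`, and is the gradient of the function `F`. -/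
structure IsCoordPair (G : E → E →L[ℝ] E →L[ℝ] ℝ) (F : E → ℝ) (P : E → E) (α : ℝ) (s : Set E) :
    Prop where
  metric : IsCoordMetric G s
  smooth : ContDiffOn ℝ ∞ F s
  field_smooth : ∀ y ∈ s, ContDiffAt ℝ ∞ P y
  gradient : ∀ y ∈ s, G y (P y) = fderiv ℝ F y
  euler : ∀ y ∈ s, fderiv ℝ F y (P y) = α * F y
  lie : ∀ y ∈ s, ∀ u v, fderiv ℝ G y (P y) u v + G y (fderiv ℝ P y u) v
      + G y u (fderiv ℝ P y v) = α * G y u v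

theorem IsCoordMetric.smul {G : E → E →L[ℝ] E →L[ℝ] ℝ} {s : Set E} (h : IsCoordMetric G s)
    {φ : E → ℝ} (hφ : ContDiffOn ℝ ∞ φ s) (h0 : ∀ y ∈ s, φ y ≠ 0) :
    IsCoordMetric (fun y ↦ φ y • G y) s where
  isOpen := h.isOpen
  smooth := hφ.smul h.smooth
  symm y hy u v := by simp [h.symm y hy u v]
  nondegenerate y hy u hu := h.nondegenerate y hy u fun v ↦ by simpa [h0 y hy] using hu v

/-- The curvature of the conformal change `v(F) G`. -/
theorem IsCoordPair.coordCurvature_conformal (hdim : Module.finrank ℝ E = 2)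
    {G : E → E →L[ℝ] E →L[ℝ] ℝ} {F : E → ℝ} {P : E → E} {α : ℝ} {s : Set E}
    (h : IsCoordPair G F P α s) (hα : α ≠ 0) {D : Set ℝ} (hD : IsOpen D) (hF : MapsTo F s D)
    (hD0 : ∀ r ∈ D, r ≠ 0) {v κ : ℝ → ℝ} (hv : ContDiffOn ℝ ∞ v D) (hv0 : ∀ r ∈ D, v r ≠ 0)
    {C : ℝ} (hκ : ∀ r ∈ D, HasDerivAt κ (-(C * v r)) r)
    (hκv : ∀ r ∈ D, α * (r * deriv v r + v r) = 2 * κ r * v r)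
    {y : E} (hy : y ∈ s) (a b c : E) :
    coordCurvature (fun y ↦ v (F y) • G y) y a b c =
      C • ((v (F y) • G y) b c • a - (v (F y) • G y) a c • b) := by
  have hG' : IsCoordMetric (fun y ↦ v (F y) • G y) s :=
    h.metric.smul (hv.comp h.smooth hF) fun y hy ↦ hv0 _ (hF hy)
  have hFd : ∀ y ∈ s, HasFDerivAt F (fderiv ℝ F y) y := fun y hy ↦
    ((h.smooth.contDiffAt (h.metric.isOpen.mem_nhds hy)).differentiableAt (by simp)).hasFDerivAt
  have hvd : ∀ y ∈ s, HasFDerivAt (fun y ↦ v (F y)) (deriv v (F y) • fderiv ℝ F y) y :=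
    fun y hy ↦ (((hv.contDiffAt (hD.mem_nhds (hF hy))).differentiableAt
      (by simp)).hasDerivAt).comp_hasFDerivAt y (hFd y hy)
  refine hG'.coordCurvature_eq_of_conformal_field hdim (P := P) (κ := fun y ↦ κ (F y))
    (fun y hy ↦ (h.field_smooth y hy).of_le two_le_infty) ?_ ?_ ?_ ?_ hy a b c
  -- By Euler's relation `v(F)` has derivative `α F v'(F)` along `P`, so the Lie derivative of `v(F)
  -- G` is `α (F v'(F) + v(F)) G`.
  · intro y hy u w
    rw [((hvd y hy).fun_smul (h.metric.hasFDerivAt hy)).fderiv]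
    have h1 := h.lie y hy u w
    have h2 := hκv _ (hF hy)
    simp [h.euler y hy]
    linear_combination v (F y) * h1 + G y u w * h2
  -- The dual of `P` is `v(F) dF`; in its derivative, `v'(F) dF ⊗ dF` and `v(F) D²F` are both
  -- symmetric.
  · intro y hy u w
    have hFdd : HasFDerivAt (fderiv ℝ F) (fderiv ℝ (fderiv ℝ F) y) y :=
      (((h.smooth.contDiffAt (h.metric.isOpen.mem_nhds hy)).fderiv_right (m := ∞)
        (by simp)).differentiableAt (by simp)).hasFDerivAt
    have hev : (fun z ↦ (v (F z) • G z) (P z)) =ᶠ[𝓝 y] fun z ↦ v (F z) • fderiv ℝ F z := by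
      filter_upwards [h.metric.isOpen.mem_nhds hy] with z hz
      simp [h.gradient z hz]
    rw [hev.fderiv_eq, ((hvd y hy).fun_smul hFdd).fderiv]
    have h3 : fderiv ℝ (fderiv ℝ F) y u w = fderiv ℝ (fderiv ℝ F) y w u :=
      (h.smooth.contDiffAt (h.metric.isOpen.mem_nhds hy)).isSymmSndFDerivAt
        (by simpa using two_le_infty) u w
    simp [h3]
    ring
  · intro y hy
    refine ((hκ _ (hF hy)).comp_hasFDerivAt y (hFd y hy)).congr_fderiv ?_
    simp [h.gradient y hy, smul_smul]
  · intro y hy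
    simp [h.gradient y hy, h.euler y hy, hα, hv0 _ (hF hy), hD0 _ (hF hy)]

end ConformalChange

/-! ### Metrics on a manifold read in a chart. -/

section Charts

variable {E : Type*} [NormedAddCommGroup E] [NormedSpace ℝ E]
  {M : Type*} [TopologicalSpace M] [ChartedSpace E M]

/-- The derivative of the inverse of a chart. -/
def symmDeriv (e : OpenPartialHomeomorph M E) (y : E) : E →L[ℝ] TangentSpace 𝓘(ℝ, E) (e.symm y) :=
  mfderiv 𝓘(ℝ, E) 𝓘(ℝ, E) e.symm y

theorem metricInChart_apply
    (g : ∀ x : M, TangentSpace 𝓘(ℝ, E) x →L[ℝ] TangentSpace 𝓘(ℝ, E) x →L[ℝ] ℝ)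
    (e : OpenPartialHomeomorph M E) (y u v : E) :
    metricInChart g e y u v = g (e.symm y) (symmDeriv e y u) (symmDeriv e y v) := rfl

variable [IsManifold 𝓘(ℝ, E) ∞ M]

omit [IsManifold 𝓘(ℝ, E) ∞ M] in
theorem mdifferentiable_of_mem_maximalAtlas {e : OpenPartialHomeomorph M E}
    (he : e ∈ IsManifold.maximalAtlas 𝓘(ℝ, E) ∞ M) :
    e.MDifferentiable 𝓘(ℝ, E) 𝓘(ℝ, E) :=
  ⟨(contMDiffOn_of_mem_maximalAtlas he).mdifferentiableOn (by simp),
    (contMDiffOn_symm_of_mem_maximalAtlas he).mdifferentiableOn (by simp)⟩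

/-- The derivative of a chart. -/
def chartDeriv (e : OpenPartialHomeomorph M E) (x : M) : TangentSpace 𝓘(ℝ, E) x →L[ℝ] E :=
  mfderiv 𝓘(ℝ, E) 𝓘(ℝ, E) e x

omit [IsManifold 𝓘(ℝ, E) ∞ M] in
-- The tangent spaces at `e.symm y` and `x` have only propositionally equal base points, so the
-- identity is read in `E`. The free `y` allows use both at `y = e x` and at `x = e.symm y`.
theorem symmDeriv_chartDeriv_of_eq {e : OpenPartialHomeomorph M E}
    (he : e ∈ IsManifold.maximalAtlas 𝓘(ℝ, E) ∞ M) {x : M} (hx : x ∈ e.source) (u : E)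
    {y : E} (hy : y = e x) : (symmDeriv e y (chartDeriv e x u) : E) = u := by
  subst hy
  exact DFunLike.congr_fun ((mdifferentiable_of_mem_maximalAtlas he).symm_comp_deriv hx) u

omit [IsManifold 𝓘(ℝ, E) ∞ M] in
theorem symmDeriv_chartDeriv {e : OpenPartialHomeomorph M E}
    (he : e ∈ IsManifold.maximalAtlas 𝓘(ℝ, E) ∞ M) {y : E} (hy : y ∈ e.target)
    (u : TangentSpace 𝓘(ℝ, E) (e.symm y)) :
    symmDeriv e y (chartDeriv e (e.symm y) u) = u :=
  symmDeriv_chartDeriv_of_eq he (e.map_target hy) u (e.right_inv hy).symm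

omit [IsManifold 𝓘(ℝ, E) ∞ M] in
theorem chartDeriv_symmDeriv {e : OpenPartialHomeomorph M E}
    (he : e ∈ IsManifold.maximalAtlas 𝓘(ℝ, E) ∞ M) {y : E} (hy : y ∈ e.target) (u : E) :
    chartDeriv e (e.symm y) (symmDeriv e y u) = u :=
  DFunLike.congr_fun ((mdifferentiable_of_mem_maximalAtlas he).comp_symm_deriv hy) u

/-- This is the tangent map of `e.symm` composed with a constant section of the tangent bundle of
`E`. -/
theorem contMDiffOn_symmDeriv {e : OpenPartialHomeomorph M E}
    (he : e ∈ IsManifold.maximalAtlas 𝓘(ℝ, E) ∞ M) (u : E) :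
    ContMDiffOn 𝓘(ℝ, E) (𝓘(ℝ, E).prod 𝓘(ℝ, E)) ∞
      (fun y ↦ Bundle.TotalSpace.mk' E (E := fun x : M ↦ TangentSpace 𝓘(ℝ, E) x) (e.symm y)
        (symmDeriv e y u)) e.target := by
  have h1 := (contMDiffOn_symm_of_mem_maximalAtlas he).contMDiffOn_tangentMapWithin (m := ∞)
    (by simp) e.open_target.uniqueMDiffOn
  have h2 : ContMDiff 𝓘(ℝ, E) 𝓘(ℝ, E).tangent ∞
      (fun y : E ↦ (⟨y, u⟩ : TangentBundle 𝓘(ℝ, E) E)) := fun y ↦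
    contMDiffAt_vectorSpace_iff_contDiffAt.2 (contDiffAt_const (c := u))
  refine (h1.comp h2.contMDiffOn (s := e.target) fun y hy ↦ hy).congr fun y hy ↦ ?_
  simp only [Function.comp, tangentMapWithin]
  rw [mfderivWithin_of_isOpen e.open_target hy]
  rfl

theorem IsPseudoRiemannianMetricOn.contDiffOn_metricInChart_apply
    {g : ∀ x : M, TangentSpace 𝓘(ℝ, E) x →L[ℝ] TangentSpace 𝓘(ℝ, E) x →L[ℝ] ℝ}
    (hg : IsPseudoRiemannianMetricOn g univ) {e : OpenPartialHomeomorph M E}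
    (he : e ∈ IsManifold.maximalAtlas 𝓘(ℝ, E) ∞ M) (u v : E) :
    ContDiffOn ℝ ∞ (fun y ↦ metricInChart g e y u v) e.target := by
  have h1 : ContMDiffOn 𝓘(ℝ, E) (𝓘(ℝ, E).prod 𝓘(ℝ, E →L[ℝ] E →L[ℝ] ℝ)) ∞
      (fun y ↦ Bundle.TotalSpace.mk' (E →L[ℝ] E →L[ℝ] ℝ)
        (E := fun x : M ↦ TangentSpace 𝓘(ℝ, E) x →L[ℝ] TangentSpace 𝓘(ℝ, E) x →L[ℝ] ℝ)
        (e.symm y) (g (e.symm y))) e.target :=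
    hg.smooth.comp (contMDiffOn_symm_of_mem_maximalAtlas he) fun _ _ ↦ mem_univ _
  have h2 : ContMDiffOn 𝓘(ℝ, E) (𝓘(ℝ, E).prod 𝓘(ℝ, ℝ)) ∞
      (fun y ↦ Bundle.TotalSpace.mk' ℝ (E := Bundle.Trivial M ℝ) (e.symm y)
        (g (e.symm y) (symmDeriv e y u) (symmDeriv e y v))) e.target :=
    ContMDiffOn.clm_bundle_apply₂ (F₁ := E) (F₂ := E) (F₃ := ℝ)
      (E₁ := fun x : M ↦ TangentSpace 𝓘(ℝ, E) x) (E₂ := fun x : M ↦ TangentSpace 𝓘(ℝ, E) x)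
      (E₃ := Bundle.Trivial M ℝ) (b := e.symm) (ψ := fun y ↦ g (e.symm y))
      h1 (contMDiffOn_symmDeriv he u) (contMDiffOn_symmDeriv he v)
  intro y hy
  have h3 := h2 y hy
  rw [Bundle.contMDiffWithinAt_totalSpace] at h3
  exact h3.2.contDiffWithinAt

theorem IsPseudoRiemannianMetricOn.contDiffOn_metricInChart [FiniteDimensional ℝ E]
    {g : ∀ x : M, TangentSpace 𝓘(ℝ, E) x →L[ℝ] TangentSpace 𝓘(ℝ, E) x →L[ℝ] ℝ}
    (hg : IsPseudoRiemannianMetricOn g univ) {e : OpenPartialHomeomorph M E}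
    (he : e ∈ IsManifold.maximalAtlas 𝓘(ℝ, E) ∞ M) :
    ContDiffOn ℝ ∞ (metricInChart g e) e.target :=
  contDiffOn_clm_apply.2 fun u ↦ contDiffOn_clm_apply.2 fun v ↦
    hg.contDiffOn_metricInChart_apply he u v

theorem IsPseudoRiemannianMetricOn.nondegenerate_metricInChart
    {g : ∀ x : M, TangentSpace 𝓘(ℝ, E) x →L[ℝ] TangentSpace 𝓘(ℝ, E) x →L[ℝ] ℝ}
    (hg : IsPseudoRiemannianMetricOn g univ) {e : OpenPartialHomeomorph M E}
    (he : e ∈ IsManifold.maximalAtlas 𝓘(ℝ, E) ∞ M) {y : E} (hy : y ∈ e.target) {u : E}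
    (hu : ∀ v, metricInChart g e y u v = 0) : u = 0 := by
  have h0 : symmDeriv e y u = 0 := by
    refine hg.nondegenerate _ (mem_univ _) _ fun v ↦ ?_
    have h1 := hu (chartDeriv e (e.symm y) v)
    rwa [metricInChart_apply, symmDeriv_chartDeriv he hy] at h1
  have h2 := chartDeriv_symmDeriv he hy u
  rw [h0, map_zero] at h2
  exact h2.symm

theorem IsPseudoRiemannianMetricOn.isCoordMetric [FiniteDimensional ℝ E]
    {g : ∀ x : M, TangentSpace 𝓘(ℝ, E) x →L[ℝ] TangentSpace 𝓘(ℝ, E) x →L[ℝ] ℝ}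
    (hg : IsPseudoRiemannianMetricOn g univ) {e : OpenPartialHomeomorph M E}
    (he : e ∈ IsManifold.maximalAtlas 𝓘(ℝ, E) ∞ M) :
    IsCoordMetric (metricInChart g e) e.target where
  isOpen := e.open_target
  smooth := hg.contDiffOn_metricInChart he
  symm y _ u v :=
    hg.symm (e.symm y) (mem_univ (e.symm y)) (symmDeriv e y u) (symmDeriv e y v)
  nondegenerate _ hy _ hu := hg.nondegenerate_metricInChart he hy hu

end Charts

/-! ### The action as a local flow in a chart, and its infinitesimal consequences. -/

section Flow

set_option maxSynthPendingDepth 5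

variable {E : Type*} [NormedAddCommGroup E] [NormedSpace ℝ E]

theorem hasDerivAt_along_fst {F : Type*} [NormedAddCommGroup F] [NormedSpace ℝ F]
    {f : ℝ × E → F} {t : ℝ} {y : E} (hf : DifferentiableAt ℝ f (t, y)) :
    HasDerivAt (fun s : ℝ ↦ f (s, y)) (fderiv ℝ f (t, y) (1, 0)) t :=
  HasFDerivAt.comp_hasDerivAt (f := fun s : ℝ ↦ (s, y)) t hf.hasFDerivAt
    ((hasDerivAt_id t).prodMk (hasDerivAt_const t y))

theorem hasFDerivAt_along_snd {F : Type*} [NormedAddCommGroup F] [NormedSpace ℝ F]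
    {f : ℝ × E → F} {t : ℝ} {y : E} (hf : DifferentiableAt ℝ f (t, y)) :
    HasFDerivAt (fun z : E ↦ f (t, z))
      ((fderiv ℝ f (t, y)).comp (ContinuousLinearMap.inr ℝ ℝ E)) y :=
  HasFDerivAt.comp (f := fun z : E ↦ (t, z)) y hf.hasFDerivAt (hasFDerivAt_prodMk_right t y)

/-- Differentiating at time zero the relation `Φ_t^* G = e^{α t} G` for a local flow `Φ`. -/
theorem lie_derivative_of_flow {G : E → E →L[ℝ] E →L[ℝ] ℝ} {Φ : ℝ × E → E} {α : ℝ} {y : E}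
    (hG : DifferentiableAt ℝ G y) (hΦ : ∀ᶠ z in 𝓝 y, ContDiffAt ℝ 2 Φ (0, z))
    (h0 : ∀ᶠ z in 𝓝 y, Φ (0, z) = z) (u v : E)
    (hom : ∀ᶠ t in 𝓝 (0 : ℝ), G (Φ (t, y)) (fderiv ℝ Φ (t, y) (0, u)) (fderiv ℝ Φ (t, y) (0, v))
      = Real.exp (α * t) * G y u v) :
    fderiv ℝ G y (fderiv ℝ Φ (0, y) (1, 0)) u v
      + G y (fderiv ℝ (fun z ↦ fderiv ℝ Φ (0, z) (1, 0)) y u) v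
      + G y u (fderiv ℝ (fun z ↦ fderiv ℝ Φ (0, z) (1, 0)) y v) = α * G y u v := by
  have hΦy := hΦ.self_of_nhds
  have hy0 := h0.self_of_nhds
  have hd1 : DifferentiableAt ℝ Φ (0, y) := hΦy.differentiableAt (by simp)
  have hd2 : DifferentiableAt ℝ (fderiv ℝ Φ) (0, y) :=
    (hΦy.fderiv_right (m := 1) (by norm_num)).differentiableAt (by simp)
  have hsym (a b : ℝ × E) :
      fderiv ℝ (fderiv ℝ Φ) (0, y) a b = fderiv ℝ (fderiv ℝ Φ) (0, y) b a :=
    hΦy.isSymmSndFDerivAt (by simp) a b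
  -- Symmetry of `D²Φ` exchanges the space derivative of the generating field with the time
  -- derivative of the differential of the flow.
  have hfield (u : E) : fderiv ℝ (fun z ↦ fderiv ℝ Φ (0, z) (1, 0)) y u
      = fderiv ℝ (fderiv ℝ Φ) (0, y) (1, 0) (0, u) := by
    rw [((hasFDerivAt_along_snd hd2).clm_apply
      (hasFDerivAt_const ((1, 0) : ℝ × E) y)).fderiv, hsym]
    simp
  have hid (u : E) : fderiv ℝ Φ (0, y) (0, u) = u := by
    have := DFunLike.congr_fun ((hasFDerivAt_along_snd hd1).unique
      ((hasFDerivAt_id y).congr_of_eventuallyEq h0)) u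
    simpa using this
  have hcurve := hasDerivAt_along_fst hd1
  have hvec (u : E) : HasDerivAt (fun t : ℝ ↦ fderiv ℝ Φ (t, y) (0, u))
      (fderiv ℝ (fderiv ℝ Φ) (0, y) (1, 0) (0, u)) 0 := by
    simpa using (hasDerivAt_along_fst hd2).clm_apply
      (hasDerivAt_const (0 : ℝ) ((0, u) : ℝ × E))
  have hGd : HasFDerivAt G (fderiv ℝ G y) (Φ (0, y)) := by rw [hy0]; exact hG.hasFDerivAt
  have hGc : HasDerivAt (fun t : ℝ ↦ G (Φ (t, y))) (fderiv ℝ G y (fderiv ℝ Φ (0, y) (1, 0))) 0 :=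
    HasFDerivAt.comp_hasDerivAt (f := fun t : ℝ ↦ Φ (t, y)) 0 hGd hcurve
  have hl := (hGc.clm_apply (hvec u)).clm_apply (hvec v)
  have hr : HasDerivAt (fun t ↦ Real.exp (α * t) * G y u v) (α * G y u v) 0 := by
    simpa using (((hasDerivAt_id (0 : ℝ)).const_mul α).exp).mul_const (G y u v)
  have := hl.unique (hr.congr_of_eventuallyEq hom)
  simp only [hid, hy0, add_apply] at this
  rw [hfield, hfield, ← this]

variable {M : Type*} [TopologicalSpace M] [ChartedSpace E M] [MulAction {t : ℝ // 0 < t} M]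

/-- The flow `(t, y) ↦ e^t • y` in a chart. -/
def flowInChart (e : OpenPartialHomeomorph M E) (p : ℝ × E) : E :=
  e (posExp p.1 • e.symm p.2)

/-- The generator of the action in a chart. -/
def fieldInChart (e : OpenPartialHomeomorph M E) (y : E) : E :=
  fderiv ℝ (flowInChart e) (0, y) (1, 0)

theorem posExp_zero : posExp 0 = 1 := Subtype.ext Real.exp_zero

omit [NormedSpace ℝ E] [ChartedSpace E M] in
theorem flowInChart_zero {e : OpenPartialHomeomorph M E} {y : E} (hy : y ∈ e.target) :
    flowInChart e (0, y) = y := by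
  simp [flowInChart, posExp_zero, e.right_inv hy]


theorem IsSmoothFreeAction.contDiffAt_flowInChart (h : IsSmoothFreeAction E M)
    {e : OpenPartialHomeomorph M E} (he : e ∈ IsManifold.maximalAtlas 𝓘(ℝ, E) ∞ M)
    {t : ℝ} {y : E} (hy : y ∈ e.target) (ht : posExp t • e.symm y ∈ e.source) :
    ContDiffAt ℝ ∞ (flowInChart e) (t, y) := by
  have h1 : ContMDiffAt 𝓘(ℝ, E) 𝓘(ℝ, E) ∞ e.symm y :=
    (contMDiffOn_symm_of_mem_maximalAtlas he).contMDiffAt (e.open_target.mem_nhds hy)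
  have h2 : ContMDiffAt 𝓘(ℝ, E) 𝓘(ℝ, E) ∞ e (posExp t • e.symm y) :=
    (contMDiffOn_of_mem_maximalAtlas he).contMDiffAt (e.open_source.mem_nhds ht)
  have h3 : ContMDiffAt (𝓘(ℝ, ℝ).prod 𝓘(ℝ, E)) (𝓘(ℝ, ℝ).prod 𝓘(ℝ, E)) ∞
      (fun p : ℝ × E ↦ (p.1, e.symm p.2)) (t, y) :=
    contMDiffAt_fst.prodMk (ContMDiffAt.comp (t, y) h1 contMDiffAt_snd)
  have h4 : ContMDiffAt (𝓘(ℝ, ℝ).prod 𝓘(ℝ, E)) 𝓘(ℝ, E) ∞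
      (fun p : ℝ × E ↦ posExp p.1 • e.symm p.2) (t, y) :=
    ContMDiffAt.comp (t, y) (h.smooth (t, e.symm y)) h3
  have h5 : ContMDiffAt (𝓘(ℝ, ℝ).prod 𝓘(ℝ, E)) 𝓘(ℝ, E) ∞ (flowInChart e) (t, y) :=
    ContMDiffAt.comp (t, y) h2 h4
  -- Identifies the product manifold structure on `ℝ × E` with its vector space structure.
  rw [← modelWithCornersSelf_prod, chartedSpaceSelf_prod] at h5
  exact h5.contDiffAt

theorem IsSmoothFreeAction.contMDiff_smul (h : IsSmoothFreeAction E M) (t : ℝ) :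
    ContMDiff 𝓘(ℝ, E) 𝓘(ℝ, E) ∞ fun x : M ↦ posExp t • x :=
  h.smooth.comp (contMDiff_const.prodMk contMDiff_id)

theorem IsSmoothFreeAction.contMDiff_orbit (h : IsSmoothFreeAction E M) (x : M) :
    ContMDiff 𝓘(ℝ, ℝ) 𝓘(ℝ, E) ∞ fun t : ℝ ↦ posExp t • x :=
  h.smooth.comp (contMDiff_id.prodMk contMDiff_const)

theorem IsSmoothFreeAction.eventually_mem_source (h : IsSmoothFreeAction E M)
    {e : OpenPartialHomeomorph M E} {y : E} (hy : y ∈ e.target) :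
    ∀ᶠ t in 𝓝 (0 : ℝ), posExp t • e.symm y ∈ e.source :=
  (h.contMDiff_orbit (e.symm y)).continuous.continuousAt.eventually_mem
    (e.open_source.mem_nhds (by simpa [posExp_zero] using e.map_target hy))

/-- For small `t` the orbit of `e.symm y` is `e.symm` applied to the flow in the chart; the chain
rule at `t = 0` concludes. -/
theorem IsSmoothFreeAction.symmDeriv_fieldInChart (h : IsSmoothFreeAction E M)
    {e : OpenPartialHomeomorph M E} (he : e ∈ IsManifold.maximalAtlas 𝓘(ℝ, E) ∞ M)
    {y : E} (hy : y ∈ e.target) :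
    symmDeriv e y (fieldInChart e y) = generator (e.symm y) := by
  have hΦ := h.contDiffAt_flowInChart he hy
    (by simpa [posExp_zero] using e.map_target hy : posExp 0 • e.symm y ∈ e.source)
  let L : ℝ →L[ℝ] E := ContinuousLinearMap.toSpanSingleton ℝ (fieldInChart e y)
  have hc : HasMFDerivAt 𝓘(ℝ, ℝ) 𝓘(ℝ, E) (fun t : ℝ ↦ flowInChart e (t, y)) 0 L :=
    (hasDerivAt_along_fst (hΦ.differentiableAt (by simp))).hasFDerivAt.hasMFDerivAt
  have hs : HasMFDerivAt 𝓘(ℝ, E) 𝓘(ℝ, E) e.symm (flowInChart e (0, y)) (symmDeriv e y) := by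
    rw [flowInChart_zero hy]
    exact ((mdifferentiable_of_mem_maximalAtlas he).mdifferentiableAt_symm hy).hasMFDerivAt
  have hev : (fun t : ℝ ↦ posExp t • e.symm y) =ᶠ[𝓝 0]
      e.symm ∘ fun t : ℝ ↦ flowInChart e (t, y) := by
    filter_upwards [h.eventually_mem_source hy] with t ht
    simp [flowInChart, e.left_inv ht]
  have hm := ((hs.comp (0 : ℝ) hc).congr_of_eventuallyEq hev).mfderiv
  rw [generator, hm]
  exact (congrArg (symmDeriv e y) (by simp [L] : L 1 = fieldInChart e y)).symm

/-- The chart intertwines the flow and the action near `y`; differentiating this conjugation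
relation turns `m_λ^* g = λ^α g` into a statement about the flow in the chart. -/
theorem IsSmoothFreeAction.symmDeriv_fderiv_flowInChart (h : IsSmoothFreeAction E M)
    {e : OpenPartialHomeomorph M E} (he : e ∈ IsManifold.maximalAtlas 𝓘(ℝ, E) ∞ M)
    {t : ℝ} {y : E} (hy : y ∈ e.target) (ht : posExp t • e.symm y ∈ e.source) (u : E) :
    (symmDeriv e (flowInChart e (t, y)) (fderiv ℝ (flowInChart e) (t, y) (0, u)) : E) =
      mfderiv 𝓘(ℝ, E) 𝓘(ℝ, E) (fun z : M ↦ posExp t • z) (e.symm y) (symmDeriv e y u) := by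
  have hΦ := h.contDiffAt_flowInChart he hy ht
  have hc : HasFDerivAt (fun z : E ↦ flowInChart e (t, z))
      ((fderiv ℝ (flowInChart e) (t, y)).comp (ContinuousLinearMap.inr ℝ ℝ E)) y :=
    hasFDerivAt_along_snd (hΦ.differentiableAt (by simp))
  have hmem : flowInChart e (t, y) ∈ e.target := e.map_source ht
  have hs : HasMFDerivAt 𝓘(ℝ, E) 𝓘(ℝ, E) e.symm (flowInChart e (t, y))
      (symmDeriv e (flowInChart e (t, y))) :=
    ((mdifferentiable_of_mem_maximalAtlas he).mdifferentiableAt_symm hmem).hasMFDerivAt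
  have h1 := hs.comp y hc.hasMFDerivAt
  have hm : HasMFDerivAt 𝓘(ℝ, E) 𝓘(ℝ, E) (fun z : M ↦ posExp t • z) (e.symm y) _ :=
    ((h.contMDiff_smul t).mdifferentiable (by simp) (e.symm y)).hasMFDerivAt
  have hs' : HasMFDerivAt 𝓘(ℝ, E) 𝓘(ℝ, E) e.symm y (symmDeriv e y) :=
    ((mdifferentiable_of_mem_maximalAtlas he).mdifferentiableAt_symm hy).hasMFDerivAt
  have h2 := hm.comp y hs'
  have hev : (fun z : M ↦ posExp t • z) ∘ e.symm =ᶠ[𝓝 y]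
      e.symm ∘ fun z : E ↦ flowInChart e (t, z) := by
    have hcont : ContinuousAt (fun z : E ↦ posExp t • e.symm z) y := h2.continuousAt
    filter_upwards [hcont.eventually_mem (e.open_source.mem_nhds ht)] with z hz
    simp [flowInChart, e.left_inv hz]
  have h3 := hasMFDerivAt_unique (h1.congr_of_eventuallyEq hev) h2
  exact DFunLike.congr_fun h3 u

variable [IsManifold 𝓘(ℝ, E) ∞ M]
  {g : ∀ x : M, TangentSpace 𝓘(ℝ, E) x →L[ℝ] TangentSpace 𝓘(ℝ, E) x →L[ℝ] ℝ}
  {f : M → ℝ} {α : ℝ}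

theorem IsHomogeneousPair.contDiffOn_function (h : IsHomogeneousPair g f α)
    {e : OpenPartialHomeomorph M E} (he : e ∈ IsManifold.maximalAtlas 𝓘(ℝ, E) ∞ M) :
    ContDiffOn ℝ ∞ (f ∘ e.symm) e.target :=
  (h.smooth.comp_contMDiffOn (contMDiffOn_symm_of_mem_maximalAtlas he)).contDiffOn

theorem IsHomogeneousPair.fderiv_function (h : IsHomogeneousPair g f α)
    {e : OpenPartialHomeomorph M E} (he : e ∈ IsManifold.maximalAtlas 𝓘(ℝ, E) ∞ M)
    {y : E} (hy : y ∈ e.target) (u : E) :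
    fderiv ℝ (f ∘ e.symm) y u = mvfderiv 𝓘(ℝ, E) f (e.symm y) (symmDeriv e y u) := by
  have hs : HasMFDerivAt 𝓘(ℝ, E) 𝓘(ℝ, E) e.symm y (symmDeriv e y) :=
    ((mdifferentiable_of_mem_maximalAtlas he).mdifferentiableAt_symm hy).hasMFDerivAt
  have hf := ((h.smooth.mdifferentiable (by simp)) (e.symm y)).hasMFDerivAt
  have := (hf.comp y hs).mfderiv
  rw [mfderiv_eq_fderiv] at this
  exact DFunLike.congr_fun this u

theorem IsHomogeneousPair.metricInChart_fieldInChart (h : IsHomogeneousPair g f α)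
    {e : OpenPartialHomeomorph M E} (he : e ∈ IsManifold.maximalAtlas 𝓘(ℝ, E) ∞ M)
    {y : E} (hy : y ∈ e.target) :
    metricInChart g e y (fieldInChart e y) = fderiv ℝ (f ∘ e.symm) y := by
  ext u
  rw [metricInChart_apply, h.action.symmDeriv_fieldInChart he hy, h.generator_eq,
    h.fderiv_function he hy]

theorem IsHomogeneousPair.contDiffAt_fieldInChart (h : IsHomogeneousPair g f α)
    {e : OpenPartialHomeomorph M E} (he : e ∈ IsManifold.maximalAtlas 𝓘(ℝ, E) ∞ M)
    {y : E} (hy : y ∈ e.target) : ContDiffAt ℝ ∞ (fieldInChart e : E → E) y := by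
  have hΦ := h.action.contDiffAt_flowInChart he hy
    (by simpa [posExp_zero] using e.map_target hy : posExp 0 • e.symm y ∈ e.source)
  have h1 : ContDiffAt ℝ ∞ (fderiv ℝ (flowInChart (M := M) e)) (0, y) :=
    hΦ.fderiv_right (by simp)
  exact (ContDiffAt.comp (f := fun z : E ↦ ((0 : ℝ), z)) y h1
    (contDiffAt_const.prodMk contDiffAt_id)).clm_apply contDiffAt_const

theorem coe_posExp_rpow (t α : ℝ) : ((posExp t : {t : ℝ // 0 < t}) : ℝ) ^ α = Real.exp (α * t) := by
  rw [posExp, ← Real.exp_mul, mul_comm]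

/-- Differentiate `f(e^t • x) = e^{α t} f(x)` at `t = 0`. -/
theorem IsHomogeneousPair.euler_inChart (h : IsHomogeneousPair g f α)
    {e : OpenPartialHomeomorph M E} (he : e ∈ IsManifold.maximalAtlas 𝓘(ℝ, E) ∞ M)
    {y : E} (hy : y ∈ e.target) :
    fderiv ℝ (f ∘ e.symm) y (fieldInChart e y) = α * (f ∘ e.symm) y := by
  have hΦ := h.action.contDiffAt_flowInChart he hy
    (by simpa [posExp_zero] using e.map_target hy : posExp 0 • e.symm y ∈ e.source)
  have hF : HasFDerivAt (f ∘ e.symm) (fderiv ℝ (f ∘ e.symm) y) (flowInChart e (0, y)) := by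
    rw [flowInChart_zero hy]
    exact (((h.contDiffOn_function he).contDiffAt
      (e.open_target.mem_nhds hy)).differentiableAt (by simp)).hasFDerivAt
  have h1 := HasFDerivAt.comp_hasDerivAt (f := fun t : ℝ ↦ flowInChart e (t, y)) 0 hF
    (hasDerivAt_along_fst (hΦ.differentiableAt (by simp)))
  have h2 : HasDerivAt (fun t ↦ Real.exp (α * t) * f (e.symm y)) (α * f (e.symm y)) 0 := by
    simpa using (((hasDerivAt_id (0 : ℝ)).const_mul α).exp).mul_const (f (e.symm y))
  refine h1.unique (h2.congr_of_eventuallyEq ?_)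
  filter_upwards [h.action.eventually_mem_source hy] with t ht
  simp only [Function.comp_apply, flowInChart, e.left_inv ht]
  rw [h.function_homogeneous, coe_posExp_rpow]

theorem IsHomogeneousPair.isCoordPair [FiniteDimensional ℝ E] (h : IsHomogeneousPair g f α)
    {e : OpenPartialHomeomorph M E} (he : e ∈ IsManifold.maximalAtlas 𝓘(ℝ, E) ∞ M) :
    IsCoordPair (metricInChart g e) (f ∘ e.symm) (fieldInChart e) α e.target where
  metric := h.metric.isCoordMetric he
  smooth := h.contDiffOn_function he
  field_smooth _ hy := h.contDiffAt_fieldInChart he hy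
  gradient _ hy := h.metricInChart_fieldInChart he hy
  euler _ hy := h.euler_inChart he hy
  lie y hy u v := by
    refine lie_derivative_of_flow (Φ := flowInChart e)
      (((h.metric.isCoordMetric he).contDiffAt hy).differentiableAt (by simp)) ?_ ?_ u v ?_
    · filter_upwards [e.open_target.mem_nhds hy] with z hz
      exact (h.action.contDiffAt_flowInChart he hz
        (by simpa [posExp_zero] using e.map_target hz)).of_le two_le_infty
    · filter_upwards [e.open_target.mem_nhds hy] with z hz using flowInChart_zero hz
    · filter_upwards [h.action.eventually_mem_source hy] with t ht
      have key := h.metric_homogeneous (posExp t) (e.symm y) (symmDeriv e y u) (symmDeriv e y v)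
      have hu := h.action.symmDeriv_fderiv_flowInChart he hy ht u
      have hv := h.action.symmDeriv_fderiv_flowInChart he hy ht v
      have hpt : e.symm (flowInChart e (t, y)) = posExp t • e.symm y := e.left_inv ht
      rw [coe_posExp_rpow] at key
      rw [metricInChart_apply, metricInChart_apply, ← key]
      -- The base points agree only propositionally, so the tangent vectors are compared as elements
      -- of `E`.
      have congr {x x' : M} (hx : x = x') {a b a' b' : E} (ha : a = a') (hb : b = b') :
          g x a b = g x' a' b' := by
        subst hx ha hb
        rfl
      exact congr hpt hu hv

end Flow

/-! ### Back to the manifold: curvature of `v(f) g`. -/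

section Curvature

set_option maxSynthPendingDepth 5

variable {E : Type*} [NormedAddCommGroup E] [NormedSpace ℝ E]
  {M : Type*} [TopologicalSpace M] [ChartedSpace E M]

theorem metricInChart_conformal
    (g : ∀ x : M, TangentSpace 𝓘(ℝ, E) x →L[ℝ] TangentSpace 𝓘(ℝ, E) x →L[ℝ] ℝ)
    (f : M → ℝ) (v : ℝ → ℝ) (e : OpenPartialHomeomorph M E) :
    metricInChart (conformal g f v) e
      = fun y ↦ v ((f ∘ e.symm) y) • metricInChart g e y := rfl

theorem metricInChart_chartDeriv
    (g : ∀ x : M, TangentSpace 𝓘(ℝ, E) x →L[ℝ] TangentSpace 𝓘(ℝ, E) x →L[ℝ] ℝ)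
    {e : OpenPartialHomeomorph M E} (he : e ∈ IsManifold.maximalAtlas 𝓘(ℝ, E) ∞ M)
    {x : M} (hx : x ∈ e.source) (A B : TangentSpace 𝓘(ℝ, E) x) :
    metricInChart g e (e x) (chartDeriv e x A) (chartDeriv e x B) = g x A B := by
  have congr {x x' : M} (hx : x = x') {a b a' b' : E} (ha : a = a') (hb : b = b') :
      g x a b = g x' a' b' := by
    subst hx ha hb
    rfl
  exact congr (e.left_inv hx) (symmDeriv_chartDeriv_of_eq he hx A rfl)
    (symmDeriv_chartDeriv_of_eq he hx B rfl)

theorem chartDeriv_isInvertible {e : OpenPartialHomeomorph M E}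
    (he : e ∈ IsManifold.maximalAtlas 𝓘(ℝ, E) ∞ M) {x : M} (hx : x ∈ e.source) :
    (chartDeriv e x).IsInvertible :=
  ⟨(mdifferentiable_of_mem_maximalAtlas he).mfderiv hx, rfl⟩

variable [IsManifold 𝓘(ℝ, E) ∞ M] [MulAction {t : ℝ // 0 < t} M]
  {g : ∀ x : M, TangentSpace 𝓘(ℝ, E) x →L[ℝ] TangentSpace 𝓘(ℝ, E) x →L[ℝ] ℝ}
  {f : M → ℝ} {α : ℝ}

theorem IsHomogeneousPair.isPseudoRiemannianMetricOn_conformal (h : IsHomogeneousPair g f α)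
    {D : Set ℝ} (hD : IsOpen D) {v : ℝ → ℝ} (hv : ContDiffOn ℝ ∞ v D) (hv0 : ∀ r ∈ D, v r ≠ 0) :
    IsPseudoRiemannianMetricOn (conformal g f v) (f ⁻¹' D) where
  isOpen := hD.preimage h.smooth.continuous
  symm x _ u v := by simp [conformal, h.metric.symm x (mem_univ x) u v]
  nondegenerate x hx u hu := h.metric.nondegenerate x (mem_univ x) u fun w ↦ by
    simpa [conformal, hv0 _ hx] using hu w
  smooth := ContMDiffOn.smul_section (f := fun x ↦ v (f x)) (s := g)
    (hv.contMDiffOn.comp h.smooth.contMDiffOn fun _ hx ↦ hx)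
    (h.metric.smooth.mono (subset_univ _))

/-- The curvature tensor of the conformal change `v(f) g` of a homogeneous pair on a surface. -/
theorem IsHomogeneousPair.curvature_conformal (hdim : Module.finrank ℝ E = 2)
    (h : IsHomogeneousPair g f α) {D : Set ℝ} (hD : IsOpen D) (hD0 : ∀ r ∈ D, r ≠ 0)
    {v κ : ℝ → ℝ} (hv : ContDiffOn ℝ ∞ v D) (hv0 : ∀ r ∈ D, v r ≠ 0) {C : ℝ}
    (hκ : ∀ r ∈ D, HasDerivAt κ (-(C * v r)) r)
    (hκv : ∀ r ∈ D, α * (r * deriv v r + v r) = 2 * κ r * v r)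
    {e : OpenPartialHomeomorph M E} (he : e ∈ IsManifold.maximalAtlas 𝓘(ℝ, E) ∞ M)
    {x : M} (hx : x ∈ e.source) (hxD : f x ∈ D) (A B Z : TangentSpace 𝓘(ℝ, E) x) :
    curvature (conformal g f v) e x A B Z
      = C • (conformal g f v x B Z • A - conformal g f v x A Z • B) := by
  have : FiniteDimensional ℝ E := Module.finite_of_finrank_eq_succ hdim
  have hp := h.isCoordPair he
  -- Nothing is known about `v` outside `D`, so the pair is restricted to the part of the chart
  -- where `f` takes values in `D`.
  have hopen : IsOpen (e.target ∩ f ∘ e.symm ⁻¹' D) :=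
    hp.smooth.continuousOn.isOpen_inter_preimage e.open_target hD
  have hp' : IsCoordPair (metricInChart g e) (f ∘ e.symm) (fieldInChart e) α
      (e.target ∩ f ∘ e.symm ⁻¹' D) :=
    { metric :=
        { isOpen := hopen
          smooth := hp.metric.smooth.mono inter_subset_left
          symm := fun y hy ↦ hp.metric.symm y hy.1
          nondegenerate := fun y hy ↦ hp.metric.nondegenerate y hy.1 }
      smooth := hp.smooth.mono inter_subset_left
      field_smooth := fun y hy ↦ hp.field_smooth y hy.1
      gradient := fun y hy ↦ hp.gradient y hy.1
      euler := fun y hy ↦ hp.euler y hy.1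
      lie := fun y hy ↦ hp.lie y hy.1 }
  have hy : e x ∈ e.target ∩ f ∘ e.symm ⁻¹' D :=
    ⟨e.map_source hx, by simpa [e.left_inv hx] using hxD⟩
  have key := hp'.coordCurvature_conformal hdim h.degree_ne_zero hD (fun y hy ↦ hy.2) hD0 hv hv0
    hκ hκv hy (chartDeriv e x A) (chartDeriv e x B) (chartDeriv e x Z)
  have hm (A B : TangentSpace 𝓘(ℝ, E) x) :
      (v ((f ∘ e.symm) (e x)) • metricInChart g e (e x)) (chartDeriv e x A) (chartDeriv e x B)
        = conformal g f v x A B :=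
    metricInChart_chartDeriv (conformal g f v) he hx A B
  rw [hm, hm, ← map_smul, ← map_smul, ← map_sub, ← map_smul] at key
  have h1 : curvature (conformal g f v) e x A B Z
      = (chartDeriv e x).inverse (coordCurvature (E := E) (metricInChart (conformal g f v) e)
        (e x) (chartDeriv e x A) (chartDeriv e x B) (chartDeriv e x Z)) := rfl
  rw [h1, metricInChart_conformal, key]
  exact (chartDeriv_isInvertible he hx).inverse_apply_self _

omit [IsManifold 𝓘(ℝ, E) ∞ M] [MulAction {t : ℝ // 0 < t} M] in
theorem hasConstSectionalCurvatureOn_of_curvature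
    {g : ∀ x : M, TangentSpace 𝓘(ℝ, E) x →L[ℝ] TangentSpace 𝓘(ℝ, E) x →L[ℝ] ℝ}
    {U : Set M} (hg : ∀ x ∈ U, ∀ A B : TangentSpace 𝓘(ℝ, E) x, g x A B = g x B A) {C : ℝ}
    (h : ∀ e ∈ IsManifold.maximalAtlas 𝓘(ℝ, E) ∞ M, ∀ x ∈ e.source ∩ U,
      ∀ A B Z : TangentSpace 𝓘(ℝ, E) x, curvature g e x A B Z = C • (g x B Z • A - g x A Z • B)) :
    HasConstSectionalCurvatureOn g U C := by
  intro e he x hx A B _ h0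
  rw [sectionalCurvature, h e he x hx, div_eq_iff h0]
  simp [hg x hx.2 B A, -mul_eq_mul_left_iff]
  ring

end Curvature

/-! ### Solutions of the Liouville equation for the conformal factor. -/

section Profiles

theorem isOpen_wDomain (s C₁ C₂ : ℝ) : IsOpen (wDomain s C₁ C₂) := by
  rw [isOpen_iff_mem_nhds]
  rintro r ⟨hr, hs, hl⟩
  have hlog : ContinuousAt (fun r ↦ Real.log r + C₂) r :=
    (Real.continuousAt_log hr.ne').add continuousAt_const
  have h1 : ∀ᶠ z in 𝓝 r, s < 0 → C₁ < 0 → Real.sin (√(-C₁) * (Real.log z + C₂)) ≠ 0 := by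
    by_cases h : s < 0 ∧ C₁ < 0
    · have hc : ContinuousAt (fun r ↦ Real.sin (√(-C₁) * (Real.log r + C₂))) r :=
        Real.continuous_sin.continuousAt.comp (continuousAt_const.mul hlog)
      filter_upwards [hc.eventually_ne (hs h.1 h.2)] with z hz _ _ using hz
    · exact .of_forall fun z h1 h2 ↦ absurd ⟨h1, h2⟩ h
  have h2 : ∀ᶠ z in 𝓝 r, s < 0 → C₁ = 0 → Real.log z + C₂ ≠ 0 := by
    by_cases h : s < 0 ∧ C₁ = 0
    · filter_upwards [hlog.eventually_ne (hl h.1 h.2)] with z hz _ _ using hz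
    · exact .of_forall fun z h1 h2 ↦ absurd ⟨h1, h2⟩ h
  filter_upwards [lt_mem_nhds hr, h1, h2] with z hz h1 h2 using ⟨hz, h1, h2⟩

theorem wDomain_of_nonneg {s : ℝ} (hs : 0 ≤ s) (C₁ C₂ : ℝ) : wDomain s C₁ C₂ = Ioi 0 := by
  ext r
  simp [wDomain, hs.not_gt]

/-- `w` is positive and smooth on `D`, and `log w` solves `(r d/dr)² log w = -2 s w` there; the
equation is expressed through the function `k = ½ r d/dr log w`. -/
def IsProfile (w : ℝ → ℝ) (s : ℝ) (D : Set ℝ) : Prop :=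
  (∀ r ∈ D, 0 < w r) ∧ ContDiffOn ℝ ∞ w D ∧ ∃ k : ℝ → ℝ, ∀ r ∈ D,
    HasDerivAt k (-(s * w r / r)) r ∧ HasDerivAt w (2 * k r * w r / r) r

theorem hasDerivAt_mul_log {r : ℝ} (hr : 0 < r) (c C₂ : ℝ) :
    HasDerivAt (fun r ↦ c * (Real.log r + C₂)) (c * r⁻¹) r :=
  ((Real.hasDerivAt_log hr.ne').add_const C₂).const_mul c

theorem contDiffAt_mul_log {r : ℝ} (hr : 0 < r) (c C₂ : ℝ) :
    ContDiffAt ℝ ∞ (fun r ↦ c * (Real.log r + C₂)) r :=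
  contDiffAt_const.mul ((Real.contDiffAt_log.2 hr.ne').add contDiffAt_const)

/-- With `x = √C₁ (log r + C₂)` one has `r d/dr = √C₁ d/dx` and `log w = const - 2 log cosh x`.
Hence `k = -√C₁ tanh x` and `r k' = -C₁ / cosh² x = -s w`. -/
theorem isProfile_cosh {s C₁ : ℝ} (hs : 0 < s) (hC : 0 < C₁) (C₂ : ℝ) :
    IsProfile (fun r ↦ C₁ / (s * Real.cosh (√C₁ * (Real.log r + C₂)) ^ 2)) s (Ioi 0) := by
  have hsq : √C₁ ^ 2 = C₁ := Real.sq_sqrt hC.le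
  refine ⟨fun r _ ↦ ?_, fun r hr ↦ ?_, fun r ↦ -(√C₁ * (Real.sinh (√C₁ * (Real.log r + C₂))
    / Real.cosh (√C₁ * (Real.log r + C₂)))), fun r hr ↦ ?_⟩
  · have := Real.cosh_pos (√C₁ * (Real.log r + C₂))
    positivity
  · have := (Real.cosh_pos (√C₁ * (Real.log r + C₂))).ne'
    exact (contDiffAt_const.div (contDiffAt_const.mul ((Real.contDiff_cosh.contDiffAt.comp r
      (contDiffAt_mul_log hr _ C₂)).pow 2)) (by simp [hs.ne', this])).contDiffWithinAt
  · have hx := hasDerivAt_mul_log hr (√C₁) C₂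
    have hc := (Real.cosh_pos (√C₁ * (Real.log r + C₂))).ne'
    have hr' : r ≠ 0 := (mem_Ioi.1 hr).ne'
    have hs' := hs.ne'
    have hcs := Real.cosh_sq (√C₁ * (Real.log r + C₂))
    constructor
    · refine HasDerivAt.congr_deriv (((hx.sinh.div hx.cosh hc).const_mul (√C₁)).neg) ?_
      field_simp
      rw [hsq]
      linear_combination -C₁ * hcs
    · refine HasDerivAt.congr_deriv ((hasDerivAt_const r C₁).div ((hx.cosh.pow 2).const_mul s) (by simp [hs', hc])) ?_
      field_simp
      ring

/-- The trigonometric analogue: `k = -√(-C₁) cot x` with `x = √(-C₁) (log r + C₂)`, and `r k' = -C₁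
/ sin² x`. -/
theorem isProfile_sin {s C₁ : ℝ} (hs : s < 0) (hC : C₁ < 0) (C₂ : ℝ) :
    IsProfile (fun r ↦ C₁ / (s * Real.sin (√(-C₁) * (Real.log r + C₂)) ^ 2)) s
      {r | 0 < r ∧ Real.sin (√(-C₁) * (Real.log r + C₂)) ≠ 0} := by
  have hsq : √(-C₁) ^ 2 = -C₁ := Real.sq_sqrt (by linarith)
  refine ⟨fun r hr ↦ ?_, fun r hr ↦ ?_, fun r ↦ -(√(-C₁) * (Real.cos (√(-C₁) * (Real.log r + C₂))
    / Real.sin (√(-C₁) * (Real.log r + C₂)))), fun r hr ↦ ?_⟩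
  · have := hr.2
    exact div_pos_of_neg_of_neg hC (mul_neg_of_neg_of_pos hs (by positivity))
  · exact (contDiffAt_const.div (contDiffAt_const.mul ((Real.contDiff_sin.contDiffAt.comp r
      (contDiffAt_mul_log hr.1 _ C₂)).pow 2)) (by simp [hs.ne, hr.2])).contDiffWithinAt
  · have hx := hasDerivAt_mul_log hr.1 (√(-C₁)) C₂
    have hc := hr.2
    have hr' : r ≠ 0 := hr.1.ne'
    have hs' := hs.ne
    have hcs := Real.sin_sq_add_cos_sq (√(-C₁) * (Real.log r + C₂))
    constructor
    · refine HasDerivAt.congr_deriv (((hx.cos.div hx.sin hc).const_mul (√(-C₁))).neg) ?_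
      field_simp
      rw [hsq]
      linear_combination -C₁ * hcs
    · refine HasDerivAt.congr_deriv ((hasDerivAt_const r C₁).div ((hx.sin.pow 2).const_mul s) (by simp [hs', hc])) ?_
      field_simp
      ring

/-- The limit `C₁ → 0` of the sine solution, with `k = -1 / (log r + C₂)`. -/
theorem isProfile_log {s : ℝ} (hs : s < 0) (C₂ : ℝ) :
    IsProfile (fun r ↦ -1 / (s * (Real.log r + C₂) ^ 2)) s
      {r | 0 < r ∧ Real.log r + C₂ ≠ 0} := by
  refine ⟨fun r hr ↦ ?_, fun r hr ↦ ?_, fun r ↦ -(1 / (Real.log r + C₂)), fun r hr ↦ ?_⟩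
  · have := hr.2
    exact div_pos_of_neg_of_neg (by norm_num) (mul_neg_of_neg_of_pos hs (by positivity))
  · exact (contDiffAt_const.div (contDiffAt_const.mul
      (((Real.contDiffAt_log.2 hr.1.ne').add contDiffAt_const).pow 2))
      (by simp [hs.ne, hr.2])).contDiffWithinAt
  · have hx := (Real.hasDerivAt_log hr.1.ne').add_const C₂
    have hc := hr.2
    have hr' : r ≠ 0 := hr.1.ne'
    have hs' := hs.ne
    constructor
    · refine HasDerivAt.congr_deriv (((hasDerivAt_const r (1 : ℝ)).div hx hc).neg) ?_
      field_simp
      ring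
    · refine HasDerivAt.congr_deriv ((hasDerivAt_const r (-1 : ℝ)).div ((hx.pow 2).const_mul s) (by simp [hs', hc])) ?_
      field_simp
      ring

/-- For `s = 0` the equation says that `k` is constant, here `m / 2`. This serves both the case `s =
0` of `w` and the flat metrics `f^β g`. -/
theorem isProfile_rpow {a : ℝ} (ha : 0 < a) (m : ℝ) :
    IsProfile (fun r ↦ a * r ^ m) 0 (Ioi 0) := by
  refine ⟨fun r (hr : 0 < r) ↦ by positivity, fun r (hr : 0 < r) ↦ ?_, fun r ↦ m / 2,
    fun r (hr : 0 < r) ↦ ⟨?_, ?_⟩⟩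
  · exact (contDiffAt_const.mul (Real.contDiffAt_rpow_const_of_ne hr.ne')).contDiffWithinAt
  · simpa using hasDerivAt_const r (m / 2)
  · refine HasDerivAt.congr_deriv ((Real.hasDerivAt_rpow_const (p := m) (.inl hr.ne')).const_mul a) ?_
    rw [Real.rpow_sub_one hr.ne']
    ring

theorem isProfile_w (σ : ℤˣ) {s C₁ C₂ : ℝ} (h : (s, C₁, C₂) ∈ Δ₁ ∪ Δ₂ ∪ Δ₃) :
    IsProfile (w σ s C₁ C₂) s (wDomain s C₁ C₂) := by
  simp only [Δ₁, Δ₂, Δ₃, mem_union, mem_ofPred_eq] at h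
  rcases h with (⟨hs, hC⟩ | ⟨rfl, hC⟩) | ⟨hs, hC⟩
  · rw [wDomain_of_nonneg hs.le]
    convert isProfile_cosh hs hC C₂ using 1
    ext r
    simp [w, hs]
  · rw [wDomain_of_nonneg le_rfl]
    convert isProfile_rpow (Real.exp_pos C₂) (((σ : ℤ) : ℝ) * (2 * √C₁)) using 1
    ext r
    simp [w]
  · rcases hC.lt_or_eq with hC | rfl
    · convert isProfile_sin hs hC C₂ using 1
      · ext r
        simp [w, hs.not_gt, hs.ne, hC]
      · ext r
        simp [wDomain, hs, hC, hC.ne]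
    · convert isProfile_log hs C₂ using 1
      · ext r
        simp [w, hs.not_gt, hs.ne]
      · ext r
        simp [wDomain, hs]

/-- The hypotheses of the curvature formula for a conformal factor `v = w / r`. -/
theorem IsProfile.conformal_factor {w : ℝ → ℝ} {s : ℝ} {D : Set ℝ} (h : IsProfile w s D)
    (hD : IsOpen D) (hpos : ∀ r ∈ D, 0 < r) {v : ℝ → ℝ} (hv : ∀ r ∈ D, v r = 1 / r * w r)
    {C α : ℝ} (hs : α * s = C) :
    (∀ r ∈ D, 0 < v r) ∧ ContDiffOn ℝ ∞ v D ∧ ∃ κ : ℝ → ℝ,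
      (∀ r ∈ D, HasDerivAt κ (-(C * v r)) r) ∧
      ∀ r ∈ D, α * (r * deriv v r + v r) = 2 * κ r * v r := by
  obtain ⟨hw, hsm, k, hk⟩ := h
  -- The choice `κ = α k` is forced by `r v' + v = (r v)' = w' = 2 k w / r = 2 k v`.
  refine ⟨fun r hr ↦ ?_, ?_, fun r ↦ α * k r, fun r hr ↦ ?_, fun r hr ↦ ?_⟩
  · have := hw r hr
    have := hpos r hr
    rw [hv r hr]
    positivity
  · exact ((contDiffOn_const.div contDiffOn_id fun r hr ↦ (hpos r hr).ne').mul hsm).congr hv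
  · refine HasDerivAt.congr_deriv ((hk r hr).1.const_mul α) ?_
    rw [hv r hr, ← hs]
    ring
  · have hr0 := (hpos r hr).ne'
    have hev : v =ᶠ[𝓝 r] fun r ↦ r⁻¹ * w r := by
      filter_upwards [hD.mem_nhds hr] with z hz using by rw [hv z hz, one_div]
    rw [hev.deriv_eq, ((hasDerivAt_inv hr0).fun_mul (hk r hr).2).deriv, hv r hr]
    field_simp
    ring

end Profiles

end HomogeneousPair

end

/-! ### The main theorem. -/

theorem corollary3p13 {E : Type*} [NormedAddCommGroup E] [NormedSpace ℝ E]
    {M : Type*} [TopologicalSpace M] [ChartedSpace E M] [IsManifold 𝓘(ℝ, E) ∞ M]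
    [MulAction {t : ℝ // 0 < t} M]
    (hdim : Module.finrank ℝ E = 2)
    (g : ∀ x : M, TangentSpace 𝓘(ℝ, E) x →L[ℝ] TangentSpace 𝓘(ℝ, E) x →L[ℝ] ℝ)
    (f : M → ℝ) (α : ℝ) (hgf : HomogeneousPair.IsHomogeneousPair g f α) :
    (∀ (C C₁ C₂ : ℝ) (σ : ℤˣ),
      (C / α, C₁, C₂) ∈ HomogeneousPair.Δ₁ ∪ HomogeneousPair.Δ₂ ∪ HomogeneousPair.Δ₃ →
      ∀ (v : ℝ → ℝ) (U : Set M),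
        (∀ r ∈ HomogeneousPair.wDomain (C / α) C₁ C₂,
          v r = 1 / r * HomogeneousPair.w σ (C / α) C₁ C₂ r) →
        U = f ⁻¹' HomogeneousPair.wDomain (C / α) C₁ C₂ →
        (0 ≤ C / α → U = univ) ∧
        (∀ x ∈ U, 0 < v (f x)) ∧
        HomogeneousPair.IsPseudoRiemannianMetricOn (HomogeneousPair.conformal g f v) U ∧
        HomogeneousPair.HasConstSectionalCurvatureOn (HomogeneousPair.conformal g f v) U C) ∧
    (∀ β : ℝ,
      HomogeneousPair.IsPseudoRiemannianMetricOn
        (HomogeneousPair.conformal g f (fun r ↦ r ^ β)) univ ∧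
      HomogeneousPair.IsFlatOn (HomogeneousPair.conformal g f (fun r ↦ r ^ β)) univ) := by
  open HomogeneousPair in
  refine ⟨fun C C₁ C₂ σ hΔ v U hv hU ↦ ?_, fun β ↦ ?_⟩
  · subst hU
    have hD := isOpen_wDomain (C / α) C₁ C₂
    have hpos : ∀ r ∈ wDomain (C / α) C₁ C₂, 0 < r := fun r hr ↦ hr.1
    obtain ⟨hv0, hsm, κ, hκ, hκv⟩ := (isProfile_w σ hΔ).conformal_factor hD hpos hv
      (mul_div_cancel₀ C hgf.degree_ne_zero)
    have hne := fun r hr ↦ (hv0 r hr).ne'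
    have hmet := hgf.isPseudoRiemannianMetricOn_conformal hD hsm hne
    refine ⟨fun hs ↦ ?_, fun x hx ↦ hv0 _ hx, hmet,
      hasConstSectionalCurvatureOn_of_curvature hmet.symm fun e he x hx A B Z ↦ ?_⟩
    · rw [wDomain_of_nonneg hs]
      exact eq_univ_of_forall hgf.pos
    · exact hgf.curvature_conformal hdim hD (fun r hr ↦ (hpos r hr).ne') hsm hne hκ hκv he
        hx.1 hx.2 A B Z
  · have huniv : f ⁻¹' Ioi 0 = univ := eq_univ_of_forall hgf.pos
    -- `r^β = (1 / r) r^(β + 1)`, a power profile with `s = 0`, hence `C = α · 0 = 0`. Every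
    -- exponent is covered directly, without solving for `C₁` and the sign.
    obtain ⟨hv0, hsm, κ, hκ, hκv⟩ := (isProfile_rpow one_pos (β + 1)).conformal_factor
      (v := fun r ↦ r ^ β) isOpen_Ioi (fun _ hr ↦ hr)
      (fun r (hr : 0 < r) ↦ by rw [Real.rpow_add_one hr.ne']; field_simp) (mul_zero α)
    have hne := fun r hr ↦ (hv0 r hr).ne'
    refine ⟨huniv ▸ hgf.isPseudoRiemannianMetricOn_conformal isOpen_Ioi hsm hne,
      fun e he x hx A B Z ↦ ?_⟩
    rw [hgf.curvature_conformal hdim isOpen_Ioi (fun r (hr : 0 < r) ↦ hr.ne') hsm hne hκ hκv he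
      hx.1 (hgf.pos x), zero_smul]
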